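/- Let $p$ be an odd prime, let $F$ be a field of characteristic $p$, and let $r\ge 1$. Let $C_2\wr S_{rp}$ be the centraliser of $(1\ \bar 1)(2\ \bar 2)\cdots(rp\ \overline{rp})$ in the symmetric group on $\{1,\dots,rp,\bar 1,\dots,\overline{rp}\}$. For $1\le j\le r$ let $$\sigma_j=((j-1)p+1\ \ldots\ jp)(\overline{(j-1)p+1}\ \ldots\ \overline{jp}),\qquad \tau_j=\prod_{i=(j-1)p+1}^{jp}(i\ \bar i),$$ let $R_r=\langle\sigma_1\sigma_2\cdots\sigma_r\rangle$, a cyclic group of order $p$, and let $N=N_{C_2\wr S_{rp}}(R_r)$, which contains $\tau_1,\dots,\tau_r$. For an $FN$-module $V$ and a subset $S\subseteq\{1,\dots,r\}$ put $$V_S=\{x\in V:\ \tau_jx=x \text{ for } j\in S,\ \ \tau_jx=-x\text{ for } j\notin S\}.$$ Then the blocks of $FN$ are labelled by the pairs $(\tilde v,\tilde w)$ of non-negative integers with $\tilde v+\tilde w=r$. That is, there is a bijection $(\tilde v,\tilde w)\mapsto b(\tilde v,\tilde w)$ from the set of these pairs to the set of blocks of $FN$, such that for every such pair an $FN$-module $V$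 lies in the block $b(\tilde v,\tilde w)$ if and only if $V=\sum_{|S|=\tilde v}V_S$. -/

import Mathlib

universe u

/-- The points `1, …, n, 1̄, …, n̄`: `(i, false)` is the point `i`, and `(i, true)` is `ī`. -/
abbrev SignedPoint (n : ℕ) : Type := Fin n × Bool

/-- The permutation `(1 1̄)(2 2̄)…(n n̄)`. -/
def barPerm (n : ℕ) : Equiv.Perm (SignedPoint n) :=
  Equiv.prodCongr (Equiv.refl (Fin n)) Equiv.boolNot

/-- The imprimitive wreath product `C₂ ≀ Sₙ`, as the centraliser of `(1 1̄)(2 2̄)…(n n̄)` in the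
symmetric group on `{1, …, n, 1̄, …, n̄}`. -/
def Hyperoctahedral (n : ℕ) : Subgroup (Equiv.Perm (SignedPoint n)) :=
  Subgroup.centralizer {barPerm n}

/-- For `π ∈ Sₙ`, the element of `C₂ ≀ Sₙ` with `i ↦ π(i)` and `ī ↦ π(i)` barred. -/
def topLift {n : ℕ} (π : Equiv.Perm (Fin n)) : Hyperoctahedral n :=
  ⟨Equiv.prodCongr π (Equiv.refl Bool), by
    rw [Hyperoctahedral, Subgroup.mem_centralizer_singleton_iff]
    rfl⟩

/-- The element of `C₂ ≀ Sₙ` that interchanges `i` and `ī` for every `i` with `P i`, and fixes all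
other points. -/
def signFlip {n : ℕ} (P : Fin n → Prop) [DecidablePred P] : Hyperoctahedral n :=
  ⟨{ toFun := fun x => (x.1, if P x.1 then !x.2 else x.2)
     invFun := fun x => (x.1, if P x.1 then !x.2 else x.2)
     left_inv := by rintro ⟨i, b⟩; by_cases h : P i <;> simp [h]
     right_inv := by rintro ⟨i, b⟩; by_cases h : P i <;> simp [h] }, by
    rw [Hyperoctahedral, Subgroup.mem_centralizer_singleton_iff]
    ext ⟨i, b⟩ : 1
    by_cases h : P i <;> simp [h, barPerm]⟩

/-- The positive `p`-cycle
`σ_j = ((j-1)p+1 … jp)(\bar{(j-1)p+1} … \bar{jp})` (with `j` starting from `0` in the code).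
The bijection `finProdFinEquiv : Fin r × Fin p ≃ Fin (r * p)` is `(j, k) ↦ j * p + k`. -/
def sigmaCycle (r p : ℕ) (j : Fin r) : Hyperoctahedral (r * p) :=
  topLift (finProdFinEquiv.permCongr (Equiv.Perm.prodExtendRight j (finRotate p)))

/-- The involution `τ_j`: the product of the transpositions `(i ī)` over the `p` points `i` in the
support of `σ_j`. -/
def tauFlip (r p : ℕ) (j : Fin r) : Hyperoctahedral (r * p) :=
  signFlip fun i => (finProdFinEquiv.symm i).1 = j

/-- The product `σ_1 σ_2 ⋯ σ_r`. -/
def sigmaProd (r p : ℕ) : Hyperoctahedral (r * p) :=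
  (List.ofFn (sigmaCycle r p)).prod

/-- The cyclic group `R_r = ⟨σ_1 σ_2 ⋯ σ_r⟩`. -/
def cyclicR (r p : ℕ) : Subgroup (Hyperoctahedral (r * p)) :=
  Subgroup.zpowers (sigmaProd r p)

/-- The normaliser of `R_r` in `C₂ ≀ S_{rp}`. -/
def normR (r p : ℕ) : Subgroup (Hyperoctahedral (r * p)) :=
  Subgroup.normalizer (cyclicR r p : Set (Hyperoctahedral (r * p)))

theorem tauFlip_commute_sigmaCycle (r p : ℕ) (i j : Fin r) :
    Commute (tauFlip r p j) (sigmaCycle r p i) := by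
  apply Subtype.ext
  ext ⟨x, b⟩ : 1
  obtain ⟨⟨a, k⟩, rfl⟩ := finProdFinEquiv.surjective x
  have key : (Equiv.Perm.prodExtendRight i (finRotate p) (a, k)).1 = a := by
    by_cases h : a = i <;> simp [Equiv.Perm.prodExtendRight, h]
  simp [tauFlip, sigmaCycle, signFlip, topLift, -finProdFinEquiv_symm_apply, key]

theorem tauFlip_mem_normR (r p : ℕ) (j : Fin r) : tauFlip r p j ∈ normR r p := by
  have h : Commute (tauFlip r p j) (sigmaProd r p) := by
    refine Commute.list_prod_right _ _ fun x hx => ?_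
    obtain ⟨i, rfl⟩ := (List.mem_ofFn' _ _).1 hx
    exact tauFlip_commute_sigmaCycle r p i j
  refine Subgroup.centralizer_le_normalizer _ ?_
  rw [Subgroup.mem_centralizer_iff]
  rintro x hx
  obtain ⟨m, rfl⟩ := Subgroup.mem_zpowers_iff.1 hx
  exact ((h.zpow_right m).eq).symm

/-- The involution `τ_j` as an element of the normaliser of `R_r`. -/
def tau (r p : ℕ) (j : Fin r) : normR r p :=
  ⟨tauFlip r p j, tauFlip_mem_normR r p j⟩

/-- A block idempotent of a ring `A`: a primitive idempotent of the centre of `A`. The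
corresponding block is the indecomposable two-sided ideal `A e`. -/
structure IsBlockIdempotent {A : Type*} [Ring A] (e : A) : Prop where
  mem_center : e ∈ Set.center A
  idem : IsIdempotentElem e
  ne_zero : e ≠ 0
  primitive : ∀ f ∈ Set.center A, IsIdempotentElem f → e * f = f → f = 0 ∨ f = e

/-- The blocks of the group algebra `F G`, each given by its block idempotent. -/
def Block (F G : Type*) [Field F] [Group G] : Type _ :=
  {e : MonoidAlgebra F G // IsBlockIdempotent e}

/-- The module (representation) `ρ` of `G` over `F` lies in the block `B`: the block idempotent
acts on it as the identity. -/
def LiesInBlock {F G V : Type*} [Field F] [Group G] [AddCommGroup V] [Module F V]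
    (ρ : Representation F G V) (B : Block F G) : Prop :=
  ρ.asAlgebraHom B.1 = 1

/-- The weight space `V^χ` for the linear character `χ` of
`C₂^r = ⟨τ_1, …, τ_r⟩` with `χ(τ_j) = 1` for `j ∈ S` and `χ(τ_j) = -1` for `j ∉ S`. -/
def weightSpace {F V : Type*} [Field F] [AddCommGroup V] [Module F V] {r p : ℕ}
    (ρ : Representation F (normR r p) V) (S : Finset (Fin r)) : Submodule F V where
  carrier := {x | ∀ j, ρ (tau r p j) x = if j ∈ S then x else -x}
  zero_mem' := by intro j; simp
  add_mem' := by
    intro x y hx hy j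
    rw [map_add, hx j, hy j]
    split_ifs <;> abel
  smul_mem' := by
    intro c x hx j
    rw [map_smul, hx j]
    split_ifs <;> simp

/-- The module `ρ` belongs to `v`: it is the sum of its weight spaces for the linear
characters of `⟨τ_1, …, τ_r⟩` that take the value `1` on exactly `v` of the `τ_j` (and `-1` on
the other ones). -/
def BelongsTo {F V : Type*} [Field F] [AddCommGroup V] [Module F V] {r p : ℕ}
    (ρ : Representation F (normR r p) V) (v : ℕ) : Prop :=
  (⨆ S : {S : Finset (Fin r) // S.card = v}, weightSpace ρ S.1) = ⊤

/-! Let `P` be the group of all shifts inside the blocks, generated by the σ_j, and `T` ≅ C₂^r the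
group generated by the τ_j. The normaliser of `R_r` permutes the r blocks and acts on them by affine
maps over `ZMod p` with one common slope, up to bars. Hence `P` is a normal `p`-subgroup, and an
element centralising `P` only shifts and bars blocks. So the centraliser of `P` is abelian, its
`p`-th powers lie in `T`, and `T` embeds in `N/P`.

For such a `P`, every central idempotent `f` of `FN` lies in `FT`
(`exists_eq_mapDomain_of_mem_center`). Let `b` be the part of `f` supported on the centraliser. Then
`f` and `b` agree in `F(N/P)`, because the other conjugation orbits of `P` have length divisible by
`p`. By Frobenius `b ^ p` lies in `FT`, and it is a central idempotent with the same image as `f`.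
No non-zero central idempotent dies in `F(N/P)`, so `f = b ^ p`.

As 2 is invertible in `F`, an element of `FT` is determined by its values at the characters of `T`,
which are indexed by the sets `S`. Conjugation by `N` induces all permutations of the τ_j, so a
central element takes equal values at sets of equal size. An idempotent takes only the values 0 and
1. The block idempotents are therefore the `levelIdem` for 0 ≤ v ≤ r, and on a module each of them
projects onto the sum of the V_S with |S| = v. -/

/-! ### Fixed points of `p`-groups in characteristic `p` -/

/-- An orbit that is not a single point has length a positive power of `p`, so its contribution is a
multiple of `p`. -/
theorem IsPGroup.sum_eq_zero_of_fixedPoints {p : ℕ} [Fact p.Prime] {F P α : Type*} [Field F]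
    [CharP F p] [Group P] [Finite P] (hP : IsPGroup p P) [Fintype α] [MulAction P α] (h : α → F)
    (hinv : ∀ (u : P) (x : α), h (u • x) = h x)
    (h0 : ∀ x ∈ MulAction.fixedPoints P α, h x = 0) : ∑ x, h x = 0 := by
  classical
  let q : α → MulAction.orbitRel.Quotient P α := Quotient.mk''
  rw [← Finset.sum_fiberwise Finset.univ q h]
  refine Finset.sum_eq_zero fun j _ => ?_
  obtain ⟨a, rfl⟩ := Quotient.mk''_surjective j
  have hmem : ∀ x, x ∈ Finset.univ.filter (fun x => q x = Quotient.mk'' a) ↔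
      x ∈ MulAction.orbit P a := by
    intro x
    rw [Finset.mem_filter]
    simp only [Finset.mem_univ, true_and, q]
    rw [Quotient.eq'']
    exact MulAction.orbitRel_apply
  have hconst : ∀ x ∈ Finset.univ.filter (fun x => q x = Quotient.mk'' a), h x = h a := by
    intro x hx
    obtain ⟨u, rfl⟩ := (hmem x).1 hx
    exact hinv u a
  rw [Finset.sum_congr rfl hconst, Finset.sum_const]
  have hcard : (Finset.univ.filter (fun x => q x = Quotient.mk'' a)).card =
      Nat.card (MulAction.orbit P a) := by
    rw [Nat.subtype_card _ hmem]
  rw [hcard]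
  obtain ⟨n, hn⟩ := hP.card_orbit a
  rcases Nat.eq_zero_or_pos n with rfl | hpos
  · have : a ∈ MulAction.fixedPoints P α := by
      have : Fintype (MulAction.orbit P a) := Fintype.ofFinite _
      rw [MulAction.mem_fixedPoints_iff_card_orbit_eq_one, ← Nat.card_eq_fintype_card, hn, pow_zero]
    rw [h0 a this, smul_zero]
  · rw [hn, nsmul_eq_mul, Nat.cast_pow, CharP.cast_eq_zero, zero_pow hpos.ne', zero_mul]

/-- A `p`-group acting linearly in characteristic `p` on a subspace `W ≠ 0` fixes a non-zero
vector of `W`. -/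
theorem IsPGroup.exists_fixed_ne_zero {p : ℕ} [hp : Fact p.Prime] {P V : Type*} [Group P]
    [Finite P] (hP : IsPGroup p P) [AddCommGroup V] [DistribMulAction P V]
    (hV : ∀ x : V, p • x = 0) (W : AddSubgroup V) (hW : ∀ (u : P), ∀ x ∈ W, u • x ∈ W)
    {x : V} (hx : x ∈ W) (hx0 : x ≠ 0) : ∃ m ∈ W, m ≠ 0 ∧ ∀ u : P, u • m = m := by
  -- The additive span of the orbit, not the `F`-span: it is finitely generated of exponent `p`,
  -- hence finite even if `F` is infinite, and fixed points can be counted modulo `p`.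
  let M : AddSubgroup V := AddSubgroup.closure (Set.range fun u : P => u • x)
  have hMW : M ≤ W := (AddSubgroup.closure_le _).2 (by rintro _ ⟨u, rfl⟩; exact hW u x hx)
  have hMs : ∀ (u : P), ∀ y ∈ M, u • y ∈ M := by
    intro u y hy
    induction hy using AddSubgroup.closure_induction with
    | mem y hy =>
      obtain ⟨v, rfl⟩ := hy
      exact AddSubgroup.subset_closure ⟨u * v, mul_smul u v x⟩
    | zero => rw [smul_zero]; exact M.zero_mem
    | add y z _ _ h1 h2 => rw [smul_add]; exact M.add_mem h1 h2
    | neg y _ h => rw [smul_neg]; exact M.neg_mem h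
  have hfg : AddGroup.FG M :=
    (AddGroup.fg_iff_addSubgroup_fg M).2
      ⟨(Set.finite_range fun u : P => u • x).toFinset, by rw [Set.Finite.coe_toFinset]⟩
  have hfin : Finite M := by
    have : Module.Finite ℤ M := Module.Finite.iff_addGroup_fg.2 hfg
    exact AddCommGroup.finite_of_fg_isAddTorsion M fun y =>
      isOfFinAddOrder_iff_nsmul_eq_zero.2 ⟨p, hp.out.pos, Subtype.ext (hV y.1)⟩
  let act : MulAction P M :=
    { smul := fun u m => ⟨u • m.1, hMs u m.1 m.2⟩
      one_smul := fun m => Subtype.ext (one_smul P m.1)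
      mul_smul := fun u v m => Subtype.ext (mul_smul u v m.1) }
  have hxM : x ∈ M := AddSubgroup.subset_closure ⟨1, one_smul P x⟩
  have hdvd : p ∣ Nat.card M := by
    have h1 : addOrderOf (⟨x, hxM⟩ : M) = p :=
      addOrderOf_eq_prime (Subtype.ext (hV x)) fun h => hx0 (congrArg Subtype.val h)
    rw [← h1]
    exact addOrderOf_dvd_natCard _
  obtain ⟨m, hm, hm0⟩ := hP.exists_fixed_point_of_prime_dvd_card_of_fixed_point M hdvd
    (a := 0) (fun u => Subtype.ext (smul_zero u))
  exact ⟨m.1, hMW m.2, fun h => hm0 (Subtype.ext h.symm),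
    fun u => congrArg Subtype.val (hm u)⟩

/-! ### Central idempotents and a normal `p`-subgroup -/

namespace MonoidAlgebra

variable {F G : Type*} [Field F] [Group G]

theorem mem_center_iff_forall_single {x : MonoidAlgebra F G} :
    x ∈ Set.center (MonoidAlgebra F G) ↔ ∀ g, single g 1 * x = x * single g 1 := by
  rw [Semigroup.mem_center_iff]
  refine ⟨fun h g => h _, fun h y => ?_⟩
  induction y using MonoidAlgebra.induction_linear with
  | zero => simp
  | add y z hy hz => rw [add_mul, mul_add, hy, hz]
  | single g a =>
    have : single g a = a • (single g 1 : MonoidAlgebra F G) := by simp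
    rw [this, smul_mul_assoc, mul_smul_comm, h g]

theorem mem_center_iff_coeff {x : MonoidAlgebra F G} :
    x ∈ Set.center (MonoidAlgebra F G) ↔ ∀ g h, x.coeff (g * h * g⁻¹) = x.coeff h := by
  rw [mem_center_iff_forall_single]
  refine forall_congr' fun g => ⟨fun H h => ?_, fun H => ?_⟩
  · have := congrArg (fun y => y.coeff (g * h)) H
    simpa using this.symm
  · ext h
    have := H (g⁻¹ * h)
    simpa using this.symm

/-- The map `FG → F(G/P)`. -/
noncomputable abbrev quotientMap (F : Type*) [Field F] {G : Type*} [Group G] (P : Subgroup G)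
    [P.Normal] : MonoidAlgebra F G →+* MonoidAlgebra F (G ⧸ P) :=
  mapDomainRingHom F (QuotientGroup.mk' P)

variable {p : ℕ} [hp : Fact p.Prime] [CharP F p] [Finite G] {P : Subgroup G} [P.Normal]

/-- A coefficient of the image is the sum of `z` over a coset of `P`. Conjugation by `P` preserves
both the coset and `z`, and its fixed points lie in the centraliser, where `z` vanishes. -/
theorem quotientMap_eq_zero (hP : IsPGroup p P) {z : MonoidAlgebra F G}
    (hz : z ∈ Set.center (MonoidAlgebra F G))
    (h0 : ∀ c ∈ Subgroup.centralizer (P : Set G), z.coeff c = 0) : quotientMap F P z = 0 := by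
  classical
  have := Fintype.ofFinite G
  rw [mem_center_iff_coeff] at hz
  ext q
  have h1 : (quotientMap F P z).coeff q =
      ∑ g : G, if (g : G ⧸ P) = q then z.coeff g else 0 := by
    simp only [quotientMap, mapDomainRingHom_apply, mapDomain, coeff_ofCoeff]
    rw [Finsupp.mapDomain, Finsupp.sum_fintype _ _ (by simp), Finsupp.finsetSum_apply]
    simp [Finsupp.single_apply]
  rw [h1]
  let act : MulAction P G := MulAction.compHom G (MulAut.conj.comp P.subtype)
  have hsmul : ∀ (u : P) (g : G), u • g = u.1 * g * u.1⁻¹ := fun u g => rfl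
  refine hP.sum_eq_zero_of_fixedPoints _ ?_ ?_
  · intro u g
    have hu : ((u.1 : G) : G ⧸ P) = 1 := (QuotientGroup.eq_one_iff _).2 u.2
    rw [hsmul, hz, QuotientGroup.mk_mul, QuotientGroup.mk_mul, QuotientGroup.mk_inv, hu, one_mul,
      inv_one, mul_one]
  · intro g hg
    rw [h0 g, ite_self]
    rw [Subgroup.mem_centralizer_iff]
    intro u hu
    have := hg ⟨u, hu⟩
    rwa [hsmul, mul_inv_eq_iff_eq_mul] at this

/-- If `e ≠ 0`, the space of `x` with `e * x = x` contains a non-zero vector `m` fixed by `P`.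
Multiplication on `m` factors through `F(G/P)`, so `m = e * m = 0`. -/
theorem eq_zero_of_quotientMap_eq_zero (hP : IsPGroup p P) {e : MonoidAlgebra F G}
    (hc : e ∈ Set.center (MonoidAlgebra F G)) (he : IsIdempotentElem e)
    (h0 : quotientMap F P e = 0) : e = 0 := by
  by_contra hne
  let act : DistribMulAction P (MonoidAlgebra F G) :=
    DistribMulAction.compHom _ ((of F G).comp P.subtype)
  have hchar : ∀ x : MonoidAlgebra F G, p • x = 0 := by
    intro x
    rw [← Nat.cast_smul_eq_nsmul F, CharP.cast_eq_zero, zero_smul]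
  obtain ⟨m, hm, hm0, hfix⟩ := hP.exists_fixed_ne_zero hchar
    (AddMonoidHom.ker (AddMonoidHom.mulLeft e - AddMonoidHom.id _)) (by
      intro u x hx
      rw [AddMonoidHom.mem_ker] at hx ⊢
      simp only [AddMonoidHom.sub_apply, AddMonoidHom.coe_mulLeft, AddMonoidHom.id_apply,
        sub_eq_zero] at hx ⊢
      change e * (single u.1 1 * x) = single u.1 1 * x
      rw [← mul_assoc, ← (Semigroup.mem_center_iff.1 hc _), mul_assoc, hx])
    (x := e) (by simp [AddMonoidHom.mem_ker, he.eq]) hne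
  simp only [AddMonoidHom.mem_ker, AddMonoidHom.sub_apply, AddMonoidHom.coe_mulLeft,
    AddMonoidHom.id_apply, sub_eq_zero] at hm
  have hfix' : ∀ u ∈ P, single u 1 * m = m := fun u hu => hfix ⟨u, hu⟩
  -- As `P` fixes `m`, the product `g * m` depends only on the coset of `g`; any representative will
  -- do.
  let L : MonoidAlgebra F (G ⧸ P) → MonoidAlgebra F G := fun y =>
    y.coeff.sum fun q a => a • (single q.out 1 * m)
  have hL : ∀ x : MonoidAlgebra F G, x * m = L (quotientMap F P x) := by
    intro x
    have hadd : ∀ y z, L (y + z) = L y + L z := fun y z =>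
      Finsupp.sum_add_index' (by simp) (by intros; rw [add_smul])
    induction x using MonoidAlgebra.induction_linear with
    | zero => simp [L]
    | add y z hy hz => rw [add_mul, map_add, hadd, hy, hz]
    | single g a =>
      obtain ⟨u, hu⟩ := QuotientGroup.mk_out_eq_mul P g
      have h1 : single g a = a • (single g 1 : MonoidAlgebra F G) := by simp
      have h2 : (single (g * u.1) 1 : MonoidAlgebra F G) = single g 1 * single u.1 1 := by simp
      simp only [L, quotientMap, mapDomainRingHom_apply, mapDomain_single, coeff_single]
      rw [Finsupp.sum_single_index (by simp), QuotientGroup.mk'_apply, hu, h2, mul_assoc,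
        hfix' u.1 u.2, h1, smul_mul_assoc]
  refine hm0 ?_
  rw [← hm, hL, h0]
  simp [L]

/-- If `C_G(P)` is commutative and its `p`-th powers lie in the image of `T`, then every central
idempotent of `FG` lies in the image of `FT`. -/
theorem exists_eq_mapDomain_of_mem_center {T : Type*} [CommGroup T] (φ : T →* G)
    (hP : IsPGroup p P)
    (hcomm : ∀ c ∈ Subgroup.centralizer (P : Set G), ∀ c' ∈ Subgroup.centralizer (P : Set G),
      c * c' = c' * c)
    (hpow : ∀ c ∈ Subgroup.centralizer (P : Set G), ∃ t, c ^ p = φ t)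
    (hinj : Function.Injective ((QuotientGroup.mk' P).comp φ)) {f : MonoidAlgebra F G}
    (hfc : f ∈ Set.center (MonoidAlgebra F G)) (hf : IsIdempotentElem f) :
    ∃ d : MonoidAlgebra F T, f = mapDomainRingHom F φ d := by
  classical
  let C := Subgroup.centralizer (P : Set G)
  let _ : CommGroup C :=
    { mul_comm := fun a b => Subtype.ext (hcomm a.1 a.2 b.1 b.2) }
  have := Fintype.ofFinite C
  choose t ht using hpow
  let b₀ : MonoidAlgebra F C := ∑ c : C, single c (f.coeff c.1)
  let b : MonoidAlgebra F G := mapDomainRingHom F C.subtype b₀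
  -- Frobenius on the commutative algebra `FC` raises coefficients and group elements of `b₀` to the
  -- `p`-th power separately.
  let d : MonoidAlgebra F T := ∑ c : C, single (t c.1 c.2) (f.coeff c.1 ^ p)
  have hbd : b ^ p = mapDomainRingHom F φ d := by
    have : CharP (MonoidAlgebra F C) p :=
      charP_of_injective_algebraMap (algebraMap F (MonoidAlgebra F C)).injective p
    rw [← map_pow, sum_pow_char, map_sum, map_sum]
    refine Finset.sum_congr rfl fun c _ => ?_
    simp [single_pow, ← ht c.1 c.2]
  have hbcoeff : ∀ g, b.coeff g = if g ∈ C then f.coeff g else 0 := by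
    intro g
    have hb : b = ∑ c : C, single c.1 (f.coeff c.1) := by
      simp [b, b₀, map_sum]
    rw [hb, coeff_sum, Finsupp.finsetSum_apply]
    split_ifs with hg
    · rw [Finset.sum_eq_single ⟨g, hg⟩]
      · simp
      · intro c _ hc
        simp [show c.1 ≠ g from fun h => hc (Subtype.ext h)]
      · simp
    · refine Finset.sum_eq_zero fun c _ => ?_
      simp [show c.1 ≠ g from fun h => hg (h ▸ c.2)]
  have hCn : C.Normal := inferInstance
  have hbc : b ∈ Set.center (MonoidAlgebra F G) := by
    rw [mem_center_iff_coeff]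
    intro g h
    rw [hbcoeff, hbcoeff, mem_center_iff_coeff.1 hfc g h, ← hCn.mem_comm_iff,
      inv_mul_cancel_left]
  have hDc : b ^ p ∈ Set.center (MonoidAlgebra F G) :=
    (Subring.center (MonoidAlgebra F G)).pow_mem hbc p
  have hqb : quotientMap F P f = quotientMap F P b := by
    rw [← sub_eq_zero, ← map_sub]
    refine quotientMap_eq_zero hP
      ((Subring.center (MonoidAlgebra F G)).sub_mem hfc hbc) fun c hc => ?_
    rw [coeff_sub, Finsupp.sub_apply, hbcoeff, if_pos hc, sub_self]
  have hqf : IsIdempotentElem (quotientMap F P f) := hf.map _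
  have hqD : quotientMap F P (b ^ p) = quotientMap F P f := by
    rw [map_pow, ← hqb, hqf.pow_eq hp.out.ne_zero]
  -- Idempotency can be tested in `F(G/P)`, since `T` embeds in `G/P`; there `b ^ p` becomes the
  -- image of `f`.
  have hD : IsIdempotentElem (b ^ p) := by
    have h1 : IsIdempotentElem d := by
      refine mapDomain_injective hinj ?_
      have h2 : ∀ y, mapDomain ((QuotientGroup.mk' P).comp φ) y =
          quotientMap F P (mapDomainRingHom F φ y) := fun y => by
        rw [quotientMap, ← RingHom.comp_apply, ← mapDomainRingHom_comp]; rfl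
      rw [h2, h2, map_mul, map_mul, ← hbd, hqD]
      exact hqf
    rw [hbd]
    exact h1.map _
  have hcm : Commute f (b ^ p) := (Semigroup.mem_center_iff.1 hDc f)
  -- `x * (1 - y)` is a central idempotent with image zero. Using this in both orders gives `x = x *
  -- y = y`.
  have key : ∀ x ∈ Set.center (MonoidAlgebra F G), ∀ y ∈ Set.center (MonoidAlgebra F G),
      IsIdempotentElem x → IsIdempotentElem y → quotientMap F P x = quotientMap F P y →
      x = x * y := by
    intro x hx y hy hxi hyi hxy
    have hcm : Commute x (1 - y) := (Semigroup.mem_center_iff.1 hx (1 - y)).symm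
    have h1 : x * (1 - y) = 0 := by
      refine eq_zero_of_quotientMap_eq_zero hP
        ((Subring.center (MonoidAlgebra F G)).mul_mem hx
          ((Subring.center (MonoidAlgebra F G)).sub_mem (Subring.one_mem _) hy)) (hxi.mul_of_commute hcm hyi.one_sub) ?_
      rw [map_mul, map_sub, map_one, ← hxy, mul_sub, mul_one, (hxi.map (quotientMap F P)).eq,
        sub_self]
    rwa [mul_sub, mul_one, sub_eq_zero] at h1
  refine ⟨d, ?_⟩
  rw [← hbd, key f hfc _ hDc hf hD hqD.symm, hcm.eq, ← key _ hDc f hfc hD hf hqD]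

end MonoidAlgebra

/-! ### Characters and idempotents of C₂^ι -/

section SignIdempotents

open MonoidAlgebra

variable {ι : Type*} [Fintype ι] [DecidableEq ι]

/-- The generator of `C₂^ι` at the place `j`. -/
abbrev signGen (j : ι) : ι → ℤˣ := Pi.mulSingle j (-1)

theorem signGen_induction {motive : (ι → ℤˣ) → Prop} (t : ι → ℤˣ) (one : motive 1)
    (mul : ∀ s t, motive s → motive t → motive (s * t)) (gen : ∀ j, motive (signGen j)) :
    motive t := by
  rw [← Finset.univ_prod_mulSingle t]
  refine Finset.prod_induction _ motive mul one fun j _ => ?_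
  rcases Int.units_eq_one_or (t j) with h | h
  · rwa [h, Pi.mulSingle_one]
  · rw [h]; exact gen j

variable (F : Type*) [Field F]

/-- The linear character of `C₂^ι` that is `1` at the places in `S` and the sign at the others. -/
noncomputable def signChar (S : Finset ι) : (ι → ℤˣ) →* F :=
  ∏ j ∈ Sᶜ, ((Int.castRingHom F : ℤ →* F).comp (Units.coeHom ℤ)).comp (Pi.evalMonoidHom _ j)

theorem signChar_apply (S : Finset ι) (t : ι → ℤˣ) :
    signChar F S t = ∏ j ∈ Sᶜ, (((t j : ℤˣ) : ℤ) : F) := by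
  simp [signChar]

theorem signChar_gen (S : Finset ι) (j : ι) :
    signChar F S (signGen j) = if j ∈ S then 1 else -1 := by
  rw [signChar_apply]
  split_ifs with h
  · refine Finset.prod_eq_one fun i hi => ?_
    have : i ≠ j := fun hij => (Finset.mem_compl.1 hi) (hij ▸ h)
    simp [signGen, Pi.mulSingle_eq_of_ne this]
  · rw [Finset.prod_eq_single_of_mem j (Finset.mem_compl.2 h)]
    · simp
    · intro i _ hij
      simp [signGen, Pi.mulSingle_eq_of_ne hij]

theorem signChar_comp_perm (S : Finset ι) (σ : Equiv.Perm ι) (t : ι → ℤˣ) :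
    signChar F S (t ∘ σ) = signChar F (S.map σ.toEmbedding) t := by
  rw [signChar_apply, signChar_apply]
  refine Finset.prod_bij (fun j _ => σ j) ?_ (fun _ _ _ _ h => σ.injective h) ?_ (fun _ _ => rfl)
  · intro j hj
    simpa using hj
  · intro i hi
    exact ⟨σ.symm i, by simpa [Finset.mem_map_equiv] using hi, by simp⟩

/-- The extension of `signChar` to the group algebra. -/
noncomputable abbrev signEval (S : Finset ι) : MonoidAlgebra F (ι → ℤˣ) →ₐ[F] F :=
  lift F F (ι → ℤˣ) (signChar F S)

/-- The primitive idempotent of `F C₂^ι` that belongs to `signChar`. -/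
noncomputable def signIdem (S : Finset ι) : MonoidAlgebra F (ι → ℤˣ) :=
  ∏ j, (2⁻¹ : F) • (1 + (if j ∈ S then 1 else -1 : F) • single (signGen j) 1)

variable {F}

theorem signEval_signIdem (h2 : (2 : F) ≠ 0) (S S' : Finset ι) :
    signEval F S' (signIdem F S) = if S' = S then 1 else 0 := by
  have h : ∀ j, signEval F S' ((2⁻¹ : F) • (1 + (if j ∈ S then 1 else -1 : F) •
      single (signGen j) 1)) = if (j ∈ S' ↔ j ∈ S) then 1 else 0 := by
    intro j
    rw [map_smul, map_add, map_one, map_smul, lift_single, signChar_gen]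
    by_cases h1 : j ∈ S <;> by_cases h3 : j ∈ S' <;> simp [h1, h3] <;>
      rw [one_add_one_eq_two, inv_mul_cancel₀ h2]
  rw [signIdem, map_prod, Finset.prod_congr rfl fun j _ => h j]
  split_ifs with hS
  · subst hS; simp
  · obtain ⟨j, hj⟩ : ∃ j, ¬(j ∈ S' ↔ j ∈ S) := by
      by_contra! hc
      exact hS (Finset.ext hc)
    exact Finset.prod_eq_zero (Finset.mem_univ j) (if_neg hj)

/-- The factor (1 ± τ_j)/2 is an eigenvector of its own generator τ_j, because τ_j² = 1. -/
theorem mul_signIdem (S : Finset ι) (d : MonoidAlgebra F (ι → ℤˣ)) :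
    d * signIdem F S = signEval F S d • signIdem F S := by
  have hgen : ∀ t : ι → ℤˣ, single t (1 : F) * signIdem F S = signChar F S t • signIdem F S := by
    intro t
    induction t using signGen_induction with
    | one => rw [map_one, one_smul, ← one_def, one_mul]
    | mul s t hs ht =>
      have : (single (s * t) 1 : MonoidAlgebra F (ι → ℤˣ)) = single s 1 * single t 1 := by simp
      rw [this, mul_assoc, ht, mul_smul_comm, hs, smul_smul, map_mul, mul_comm]
    | gen j =>
      rw [signIdem, ← Finset.mul_prod_erase _ _ (Finset.mem_univ j), ← mul_assoc, ← smul_mul_assoc]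
      congr 1
      have hsq : (single (signGen j) 1 * single (signGen j) 1 : MonoidAlgebra F (ι → ℤˣ)) = 1 := by
        rw [single_mul_single, one_mul, one_def, signGen, ← Pi.mulSingle_mul]
        simp
      rw [signChar_gen, mul_smul_comm, mul_add, mul_one, mul_smul_comm, hsq, smul_comm _ (2⁻¹ : F),
        smul_add, smul_smul]
      split_ifs <;> simp [add_comm]
  induction d using MonoidAlgebra.induction_linear with
  | zero => simp
  | add x y hx hy => rw [add_mul, hx, hy, map_add, add_smul]
  | single t a =>
    have : single t a = a • (single t 1 : MonoidAlgebra F (ι → ℤˣ)) := by simp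
    rw [this, smul_mul_assoc, hgen, map_smul, lift_single, one_smul, smul_eq_mul, mul_smul]

/-- Expand the product over j of (1 + τ_j)/2 + (1 − τ_j)/2 = 1. -/
theorem sum_signIdem (h2 : (2 : F) ≠ 0) : ∑ S : Finset ι, signIdem F S = 1 := by
  have h : ∀ j : ι, ((2⁻¹ : F) • (1 + single (signGen j) 1) +
      (2⁻¹ : F) • (1 + (-1 : F) • single (signGen j) 1) : MonoidAlgebra F (ι → ℤˣ)) = 1 := by
    intro j
    rw [← smul_add, neg_one_smul, add_add_add_comm, add_neg_cancel, add_zero, ← two_smul F,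
      smul_smul, inv_mul_cancel₀ h2, one_smul]
  rw [← Finset.prod_eq_one fun j (_ : j ∈ Finset.univ) => h j, Finset.prod_add,
    Finset.powerset_univ]
  refine Finset.sum_congr rfl fun S _ => ?_
  rw [signIdem, ← Finset.prod_mul_prod_compl S, Finset.compl_eq_univ_sdiff]
  congr 1 <;> refine Finset.prod_congr rfl fun j hj => ?_
  · rw [if_pos hj, one_smul]
  · rw [if_neg (Finset.mem_sdiff.1 hj).2]

/-- Each `x` is the sum of the `signEval F S x • signIdem F S`, so identities in the group algebra
reduce to scalars. -/
theorem signEval_ext (h2 : (2 : F) ≠ 0) {x y : MonoidAlgebra F (ι → ℤˣ)}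
    (h : ∀ S, signEval F S x = signEval F S y) : x = y := by
  rw [← mul_one x, ← mul_one y, ← sum_signIdem h2, Finset.mul_sum, Finset.mul_sum]
  refine Finset.sum_congr rfl fun S _ => ?_
  rw [mul_signIdem, mul_signIdem, h]

variable (ι F) in
/-- The sum of the `signIdem F S` with `|S| = v`. -/
noncomputable def levelIdem (v : ℕ) : MonoidAlgebra F (ι → ℤˣ) :=
  ∑ S ∈ Finset.univ.filter (fun S : Finset ι => S.card = v), signIdem F S

theorem signEval_levelIdem (h2 : (2 : F) ≠ 0) (v : ℕ) (S : Finset ι) :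
    signEval F S (levelIdem ι F v) = if S.card = v then 1 else 0 := by
  rw [levelIdem, map_sum]
  simp only [signEval_signIdem h2]
  rw [Finset.sum_ite_eq]
  simp

theorem levelIdem_idem (h2 : (2 : F) ≠ 0) (v : ℕ) : IsIdempotentElem (levelIdem ι F v) :=
  signEval_ext h2 fun S => by rw [map_mul, signEval_levelIdem h2]; simp

theorem sum_levelIdem (h2 : (2 : F) ≠ 0) :
    ∑ v ∈ Finset.range (Fintype.card ι + 1), levelIdem ι F v = 1 :=
  signEval_ext h2 fun S => by
    rw [map_sum, map_one, Finset.sum_congr rfl fun v _ => signEval_levelIdem h2 v S,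
      Finset.sum_ite_eq, if_pos]
    exact Finset.mem_range.2 (Nat.lt_succ_of_le S.card_le_univ)

theorem signEval_mapDomain_comp (S : Finset ι) (σ : Equiv.Perm ι)
    (d : MonoidAlgebra F (ι → ℤˣ)) :
    signEval F S (mapDomain (fun t => t ∘ σ) d) = signEval F (S.map σ.toEmbedding) d := by
  induction d using MonoidAlgebra.induction_linear with
  | zero => simp
  | add x y hx hy => rw [mapDomain_add, map_add, map_add, hx, hy]
  | single t a => rw [mapDomain_single, lift_single, lift_single, signChar_comp_perm]

theorem asAlgebraHom_mapDomain_apply {G V : Type*} [Group G] [AddCommGroup V] [Module F V]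
    (ρ : Representation F G V) (φ : (ι → ℤˣ) →* G) {S : Finset ι} {x : V}
    (hx : ∀ j, ρ (φ (signGen j)) x = if j ∈ S then x else -x) (d : MonoidAlgebra F (ι → ℤˣ)) :
    ρ.asAlgebraHom (mapDomainRingHom F φ d) x = signEval F S d • x := by
  have hgen : ∀ t, ρ (φ t) x = signChar F S t • x := by
    intro t
    induction t using signGen_induction with
    | one => simp
    | mul s t hs ht =>
      rw [map_mul, map_mul, Module.End.mul_apply, ht, map_smul, hs, smul_smul, map_mul, mul_comm]
    | gen j => rw [hx, signChar_gen]; split_ifs <;> simp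
  induction d using MonoidAlgebra.induction_linear with
  | zero => simp
  | add y z hy hz => rw [map_add, map_add, LinearMap.add_apply, hy, hz, map_add, add_smul]
  | single t a =>
    rw [mapDomainRingHom_apply, mapDomain_single, Representation.asAlgebraHom_single, lift_single,
      LinearMap.smul_apply, hgen, smul_smul, smul_eq_mul]

/-! ### Block idempotents of a group that permutes the factors of C₂^ι -/

section Blocks

variable {G : Type*} [Group G] (φ : (ι → ℤˣ) →* G)

theorem single_mul_mapDomain {κ : Type*} (φ : (κ → ℤˣ) →* G) {g : G} {σ : Equiv.Perm κ} (hg : ∀ t, g * φ t * g⁻¹ = φ (t ∘ σ))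
    (d : MonoidAlgebra F (κ → ℤˣ)) :
    single g 1 * mapDomainRingHom F φ d =
      mapDomainRingHom F φ (mapDomain (fun t => t ∘ σ) d) * single g 1 := by
  induction d using MonoidAlgebra.induction_linear with
  | zero => simp
  | add y z hy hz => rw [map_add, mul_add, hy, hz, mapDomain_add, map_add, add_mul]
  | single t a =>
    simp only [mapDomainRingHom_apply, mapDomain_single, single_mul_single, one_mul, mul_one]
    rw [← hg, inv_mul_cancel_right]

theorem mapDomain_levelIdem_mem_center (h2 : (2 : F) ≠ 0)
    (hconj : ∀ g, ∃ σ : Equiv.Perm ι, ∀ t, g * φ t * g⁻¹ = φ (t ∘ σ)) (v : ℕ) :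
    mapDomainRingHom F φ (levelIdem ι F v) ∈ Set.center (MonoidAlgebra F G) := by
  rw [mem_center_iff_forall_single]
  intro g
  obtain ⟨σ, hσ⟩ := hconj g
  rw [single_mul_mapDomain φ hσ]
  congr 2
  refine signEval_ext h2 fun S => ?_
  rw [signEval_mapDomain_comp, signEval_levelIdem h2, signEval_levelIdem h2, Finset.card_map]

/-- A permutation carrying `S` to `S'` is realised by conjugation, which fixes the central element.
-/
theorem signEval_eq_of_mem_center (hφ : Function.Injective φ)
    (hperm : ∀ σ : Equiv.Perm ι, ∃ g, ∀ t, g * φ t * g⁻¹ = φ (t ∘ σ))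
    {d : MonoidAlgebra F (ι → ℤˣ)}
    (hd : mapDomainRingHom F φ d ∈ Set.center (MonoidAlgebra F G)) {S S' : Finset ι}
    (h : S.card = S'.card) : signEval F S d = signEval F S' d := by
  obtain ⟨σ, rfl⟩ : ∃ σ : Equiv.Perm ι, S.map σ.toEmbedding = S' := by
    let e : {x // x ∈ S} ≃ {x // x ∈ S'} := Finset.equivOfCardEq h
    refine ⟨e.extendSubtype, Finset.eq_of_subset_of_card_le ?_ (by rw [Finset.card_map, h])⟩
    intro x hx
    obtain ⟨y, hy, rfl⟩ := Finset.mem_map.1 hx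
    exact e.extendSubtype_mem y hy
  obtain ⟨g, hg⟩ := hperm σ
  have h1 := mem_center_iff_forall_single.1 hd g
  have h3 : (single g 1 * single g⁻¹ 1 : MonoidAlgebra F G) = 1 := by simp [one_def]
  rw [single_mul_mapDomain φ hg] at h1
  have h4 := congrArg (· * single g⁻¹ 1) h1
  simp only [mul_assoc, h3, mul_one] at h4
  have h5 : mapDomain (fun t => t ∘ σ) d = d := mapDomain_injective hφ h4
  rw [← signEval_mapDomain_comp, h5]

theorem isBlockIdempotent_levelIdem (hφ : Function.Injective φ) (h2 : (2 : F) ≠ 0)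
    (hconj : ∀ g, ∃ σ : Equiv.Perm ι, ∀ t, g * φ t * g⁻¹ = φ (t ∘ σ))
    (hperm : ∀ σ : Equiv.Perm ι, ∃ g, ∀ t, g * φ t * g⁻¹ = φ (t ∘ σ))
    (hidem : ∀ f ∈ Set.center (MonoidAlgebra F G), IsIdempotentElem f →
      ∃ d, f = mapDomainRingHom F φ d)
    {v : ℕ} (hv : v ≤ Fintype.card ι) :
    IsBlockIdempotent (mapDomainRingHom F φ (levelIdem ι F v)) where
  mem_center := mapDomain_levelIdem_mem_center φ h2 hconj v
  idem := (levelIdem_idem h2 v).map _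
  ne_zero h := by
    have h0 : levelIdem ι F v = 0 := mapDomain_injective hφ (h.trans (by simp))
    obtain ⟨S, -, hS⟩ := Finset.exists_subset_card_eq (s := (Finset.univ : Finset ι)) hv
    have := signEval_levelIdem h2 v S
    rw [h0, map_zero, if_pos hS] at this
    exact zero_ne_one this
  primitive f hfc hf hvf := by
    obtain ⟨d, rfl⟩ := hidem f hfc hf
    have hd : IsIdempotentElem d := mapDomain_injective hφ ((map_mul _ d d).trans hf)
    have hvd : levelIdem ι F v * d = d := mapDomain_injective hφ ((map_mul _ _ d).trans hvf)
    have hev : ∀ S, signEval F S d = 0 ∨ signEval F S d = 1 := fun S =>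
      IsIdempotentElem.iff_eq_zero_or_one.1 (hd.map (signEval F S))
    have hne : ∀ S : Finset ι, S.card ≠ v → signEval F S d = 0 := fun S hS => by
      rw [← hvd, map_mul, signEval_levelIdem h2, if_neg hS, zero_mul]
    by_cases h : ∀ S, signEval F S d = 0
    · left
      rw [signEval_ext h2 (x := d) (y := 0) fun S => by rw [h, map_zero], map_zero]
    · right
      push Not at h
      obtain ⟨S, hS⟩ := h
      have hSv : S.card = v := by_contra fun h => hS (hne S h)
      congr 1
      refine signEval_ext h2 fun S' => ?_
      rw [signEval_levelIdem h2]
      split_ifs with hS'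
      · rw [signEval_eq_of_mem_center φ hφ hperm hfc (hS'.trans hSv.symm)]
        exact (hev S).resolve_left hS
      · exact hne S' hS'

/-- The level idempotents sum to 1, so `e` has a non-zero product with one of them; by primitivity
of both, that product equals each factor. -/
theorem IsBlockIdempotent.exists_eq_levelIdem (hφ : Function.Injective φ) (h2 : (2 : F) ≠ 0)
    (hconj : ∀ g, ∃ σ : Equiv.Perm ι, ∀ t, g * φ t * g⁻¹ = φ (t ∘ σ))
    (hperm : ∀ σ : Equiv.Perm ι, ∃ g, ∀ t, g * φ t * g⁻¹ = φ (t ∘ σ))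
    (hidem : ∀ f ∈ Set.center (MonoidAlgebra F G), IsIdempotentElem f →
      ∃ d, f = mapDomainRingHom F φ d)
    {e : MonoidAlgebra F G} (he : IsBlockIdempotent e) :
    ∃ v ≤ Fintype.card ι, e = mapDomainRingHom F φ (levelIdem ι F v) := by
  have hsum : ∑ v ∈ Finset.range (Fintype.card ι + 1),
      e * mapDomainRingHom F φ (levelIdem ι F v) ≠ 0 := by
    rw [← Finset.mul_sum, ← map_sum, sum_levelIdem h2, map_one, mul_one]
    exact he.ne_zero
  obtain ⟨v, hv, hne⟩ := Finset.exists_ne_zero_of_sum_ne_zero hsum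
  have hv : v ≤ Fintype.card ι := Nat.le_of_lt_succ (Finset.mem_range.1 hv)
  have hb := isBlockIdempotent_levelIdem φ hφ h2 hconj hperm hidem hv
  have hcm : Commute e (mapDomainRingHom F φ (levelIdem ι F v)) :=
    Semigroup.mem_center_iff.1 hb.mem_center e
  have hc := (Subring.center (MonoidAlgebra F G)).mul_mem he.mem_center hb.mem_center
  have hi := he.idem.mul_of_commute hcm hb.idem
  have h1 := (he.primitive _ hc hi (by rw [← mul_assoc, he.idem.eq])).resolve_left hne
  have h3 := (hb.primitive _ hc hi (by
    rw [hcm.eq, ← mul_assoc, hb.idem.eq])).resolve_left hne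
  exact ⟨v, hv, h1.symm.trans h3⟩

end Blocks

end SignIdempotents

/-! ### The normaliser in block coordinates -/

section Normaliser

/-- The action of a sign on `Bool`: `-1` interchanges the two elements. -/
def flipBool (u : ℤˣ) (b : Bool) : Bool := if u = -1 then !b else b

theorem flipBool_one (b : Bool) : flipBool 1 b = b := by cases b <;> rfl

theorem flipBool_neg_one (b : Bool) : flipBool (-1) b = !b := by cases b <;> rfl

theorem flipBool_mul (u v : ℤˣ) (b : Bool) : flipBool (u * v) b = flipBool u (flipBool v b) := by
  rcases Int.units_eq_one_or u with rfl | rfl <;> rcases Int.units_eq_one_or v with rfl | rfl <;>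
    cases b <;> rfl

theorem flipBool_comm (u v : ℤˣ) (b : Bool) :
    flipBool u (flipBool v b) = flipBool v (flipBool u b) := by
  rw [← flipBool_mul, mul_comm, flipBool_mul]

theorem flipBool_not (u : ℤˣ) (b : Bool) : flipBool u (!b) = !flipBool u b := by
  rcases Int.units_eq_one_or u with rfl | rfl <;> cases b <;> rfl

theorem flipBool_left_injective (b : Bool) : Function.Injective fun u => flipBool u b :=
  fun u v h => by
    rcases Int.units_eq_one_or u with rfl | rfl <;> rcases Int.units_eq_one_or v with rfl | rfl <;>
      cases b <;> simp_all [flipBool]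

theorem exists_flipBool_eq (b b' : Bool) : ∃ u, flipBool u b = b' := by
  cases b <;> cases b'
  exacts [⟨1, rfl⟩, ⟨-1, rfl⟩, ⟨-1, rfl⟩, ⟨1, rfl⟩]

theorem mem_normR_of_commute {r p : ℕ} {g : Hyperoctahedral (r * p)} (h : Commute g (sigmaProd r p)) :
    g ∈ normR r p := by
  refine Subgroup.centralizer_le_normalizer _ ?_
  rw [Subgroup.mem_centralizer_iff]
  rintro x hx
  obtain ⟨m, rfl⟩ := Subgroup.mem_zpowers_iff.1 hx
  exact ((h.zpow_right m).eq).symm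

variable {r p : ℕ} [NeZero p]

/-- The point of the block `j` with coordinate `k` in the cycle `σ_j`, barred if `b` is `true`. -/
def blockPoint (j : Fin r) (k : ZMod p) (b : Bool) : SignedPoint (r * p) :=
  (finProdFinEquiv (j, (ZMod.finEquiv p).symm k), b)

theorem blockPoint_inj {j j' : Fin r} {k k' : ZMod p} {b b' : Bool} :
    blockPoint j k b = blockPoint j' k' b' ↔ j = j' ∧ k = k' ∧ b = b' := by
  simp only [blockPoint, Prod.mk.injEq, EmbeddingLike.apply_eq_iff_eq, and_assoc]

theorem exists_eq_blockPoint (x : SignedPoint (r * p)) :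
    ∃ j k b, x = blockPoint (r := r) (p := p) j k b := by
  obtain ⟨x, b⟩ := x
  obtain ⟨⟨j, k⟩, rfl⟩ := finProdFinEquiv.surjective x
  exact ⟨j, ZMod.finEquiv p k, b, by simp [blockPoint]⟩

theorem hyperoctahedral_ext {g h : Hyperoctahedral (r * p)}
    (H : ∀ (j : Fin r) (k : ZMod p) b, g.1 (blockPoint j k b) = h.1 (blockPoint j k b)) :
    g = h := by
  refine Subtype.ext (Equiv.ext fun x => ?_)
  obtain ⟨j, k, b, rfl⟩ := exists_eq_blockPoint x
  exact H j k b

theorem normR_ext {g h : normR r p}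
    (H : ∀ (j : Fin r) (k : ZMod p) b, g.1.1 (blockPoint j k b) = h.1.1 (blockPoint j k b)) :
    g = h :=
  Subtype.ext (hyperoctahedral_ext H)

theorem hyperoctahedral_apply_not (g : Hyperoctahedral (r * p)) {j j' : Fin r} {k k' : ZMod p}
    {b b' : Bool} (h : g.1 (blockPoint j k b) = blockPoint j' k' b') :
    g.1 (blockPoint j k (!b)) = blockPoint j' k' (!b') := by
  have hg := Subgroup.mem_centralizer_singleton_iff.1 g.2
  have := DFunLike.congr_fun hg (blockPoint j k b)
  rw [Equiv.Perm.mul_apply, Equiv.Perm.mul_apply, h] at this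
  exact this

theorem sigmaCycle_blockPoint (i j : Fin r) (k : ZMod p) (b : Bool) :
    (sigmaCycle r p i).1 (blockPoint j k b) = blockPoint j (if j = i then k + 1 else k) b := by
  have : (sigmaCycle r p i).1 (blockPoint j k b) =
      (finProdFinEquiv (Equiv.Perm.prodExtendRight i (finRotate p)
        (j, (ZMod.finEquiv p).symm k)), b) := by
    simp [sigmaCycle, topLift, blockPoint, -finProdFinEquiv_symm_apply]
  rw [this]
  split_ifs with h
  · subst h
    rw [Equiv.Perm.prodExtendRight_apply_eq, finRotate_apply, blockPoint, map_add, map_one]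
  · rw [Equiv.Perm.prodExtendRight_apply_ne _ h, blockPoint]

theorem sigmaProd_blockPoint (j : Fin r) (k : ZMod p) (b : Bool) :
    (sigmaProd r p).1 (blockPoint j k b) = blockPoint j (k + 1) b := by
  -- For induction over partial products; without repetitions each block is shifted at most once.
  have key : ∀ L : List (Fin r), L.Nodup → ((L.map (sigmaCycle r p)).prod).1 (blockPoint j k b) =
      blockPoint j (if j ∈ L then k + 1 else k) b := by
    intro L
    induction L with
    | nil => intro; simp
    | cons i L ih =>
      intro hL
      rw [List.nodup_cons] at hL
      rw [List.map_cons, List.prod_cons, Subgroup.coe_mul, Equiv.Perm.mul_apply, ih hL.2,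
        sigmaCycle_blockPoint]
      by_cases h : j = i
      · subst h; simp [hL.1]
      · simp [h]
  have := key (List.finRange r) (List.nodup_finRange r)
  rwa [if_pos (List.mem_finRange j), ← List.ofFn_eq_map] at this

theorem sigmaProd_pow_blockPoint (n : ℕ) (j : Fin r) (k : ZMod p) (b : Bool) :
    (sigmaProd r p ^ n).1 (blockPoint j k b) = blockPoint j (k + (n : ZMod p)) b := by
  induction n with
  | zero => simp
  | succ n ih =>
    rw [pow_succ', Subgroup.coe_mul, Equiv.Perm.mul_apply, ih, sigmaProd_blockPoint]
    push_cast
    rw [add_assoc]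

theorem signFlip_blockPoint (t : Fin r → ℤˣ) (j : Fin r) (k : ZMod p) (b : Bool) :
    (signFlip fun i => t (finProdFinEquiv.symm i : Fin r × Fin p).1 = -1).1 (blockPoint j k b) =
      blockPoint j k (flipBool (t j) b) := by
  simp [signFlip, blockPoint, flipBool, -finProdFinEquiv_symm_apply]

variable (r p) in
/-- The embedding of `C₂^r` whose image is `⟨τ_1, …, τ_r⟩`. -/
def tauHom : (Fin r → ℤˣ) →* normR r p where
  toFun t := ⟨signFlip fun i => t (finProdFinEquiv.symm i : Fin r × Fin p).1 = -1,
    mem_normR_of_commute (hyperoctahedral_ext fun j k b => by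
      simp only [Subgroup.coe_mul, Equiv.Perm.mul_apply, sigmaProd_blockPoint,
        signFlip_blockPoint])⟩
  map_one' := normR_ext fun j k b => by
    refine (signFlip_blockPoint 1 j k b).trans ?_
    rw [Pi.one_apply, flipBool_one]; rfl
  map_mul' s t := normR_ext fun j k b => by
    simp only [Subgroup.coe_mul, Equiv.Perm.mul_apply, signFlip_blockPoint]
    rw [Pi.mul_apply, flipBool_mul]

theorem tauHom_blockPoint (t : Fin r → ℤˣ) (j : Fin r) (k : ZMod p) (b : Bool) :
    (tauHom r p t).1.1 (blockPoint j k b) = blockPoint j k (flipBool (t j) b) :=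
  signFlip_blockPoint t j k b

theorem tauHom_signGen (j : Fin r) : tauHom r p (signGen j) = tau r p j := by
  refine normR_ext fun i k b => ?_
  rw [tauHom_blockPoint]
  by_cases h : i = j
  · subst h
    simp [tau, tauFlip, signFlip, blockPoint, signGen, flipBool_neg_one,
      -finProdFinEquiv_symm_apply]
  · simp [tau, tauFlip, signFlip, blockPoint, signGen, flipBool_one, h,
      -finProdFinEquiv_symm_apply]

theorem exists_tauHom_conj_eq_comp (σ : Equiv.Perm (Fin r)) :
    ∃ g, ∀ t, g * tauHom r p t * g⁻¹ = tauHom r p (t ∘ σ) := by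
  -- The inverse of `σ`: block `i` of the conjugate comes from block `σ i`, which gives `t ∘ σ`.
  let g₀ : Hyperoctahedral (r * p) :=
    topLift (finProdFinEquiv.permCongr (Equiv.prodCongr σ.symm (Equiv.refl (Fin p))))
  have hg₀ : ∀ (j : Fin r) (k : ZMod p) b, g₀.1 (blockPoint j k b) =
      blockPoint (σ.symm j) k b := by
    intro j k b
    simp [g₀, topLift, blockPoint, -finProdFinEquiv_symm_apply]
  refine ⟨⟨g₀, mem_normR_of_commute (hyperoctahedral_ext fun j k b => ?_)⟩, fun t => ?_⟩
  · simp only [Subgroup.coe_mul, Equiv.Perm.mul_apply, sigmaProd_blockPoint, hg₀]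
  · rw [mul_inv_eq_iff_eq_mul]
    refine normR_ext fun j k b => ?_
    simp only [Subgroup.coe_mul, Equiv.Perm.mul_apply, hg₀, tauHom_blockPoint,
      Function.comp_apply, Equiv.apply_symm_apply]

variable [Fact p.Prime]

/-- In block coordinates an element of the normaliser permutes the blocks, acts on them by affine
maps with a common slope, and bars or does not bar each block. -/
theorem normR_exists_coordinates (hr : 0 < r) (g : normR r p) :
    ∃ (π : Equiv.Perm (Fin r)) (m : ZMod p) (c : Fin r → ZMod p) (t : Fin r → ℤˣ), m ≠ 0 ∧
      ∀ j k b, g.1.1 (blockPoint j k b) = blockPoint (π j) (c j + m * k) (flipBool (t j) b) := by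
  have h1 : g.1 * sigmaProd r p * g.1⁻¹ ∈ cyclicR r p :=
    (Subgroup.mem_normalizer_iff.1 g.2 _).1 (Subgroup.mem_zpowers _)
  obtain ⟨n, hn⟩ : g.1 * sigmaProd r p * g.1⁻¹ ∈ Submonoid.powers (sigmaProd r p) :=
    mem_powers_iff_mem_zpowers.2 h1
  simp only [eq_mul_inv_iff_mul_eq] at hn
  have hstep : ∀ x, g.1.1 ((sigmaProd r p).1 x) = (sigmaProd r p ^ n).1 (g.1.1 x) := fun x =>
    (DFunLike.congr_fun (congrArg Subtype.val hn) x).symm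
  have h0 : ∀ j : Fin r, ∃ (i : Fin r) (k : ZMod p) (u : ℤˣ),
      g.1.1 (blockPoint j (0 : ZMod p) false) = blockPoint i k (flipBool u false) := by
    intro j
    obtain ⟨i, k, b, h⟩ := exists_eq_blockPoint (r := r) (p := p) (g.1.1 (blockPoint j 0 false))
    obtain ⟨u, rfl⟩ := exists_flipBool_eq false b
    exact ⟨i, k, u, h⟩
  choose π c t h0 using h0
  -- The image of one point of a block determines the rest, since `g` turns a step of the cycle into
  -- `n` steps.
  have hfalse : ∀ j (l : ℕ), g.1.1 (blockPoint j (l : ZMod p) false) =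
      blockPoint (π j) (c j + (n : ZMod p) * (l : ZMod p)) (flipBool (t j) false) := by
    intro j l
    induction l with
    | zero => simpa using h0 j
    | succ l ih =>
      have := hstep (blockPoint j (l : ZMod p) false)
      rw [sigmaProd_blockPoint, ih, sigmaProd_pow_blockPoint] at this
      push_cast
      rw [this]
      congr 1
      ring
  have hform : ∀ j (k : ZMod p) b, g.1.1 (blockPoint j k b) =
      blockPoint (π j) (c j + (n : ZMod p) * k) (flipBool (t j) b) := by
    intro j k b
    have hk : g.1.1 (blockPoint j k false) =
        blockPoint (π j) (c j + (n : ZMod p) * k) (flipBool (t j) false) := by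
      simpa using hfalse j k.val
    cases b
    · exact hk
    · have := hyperoctahedral_apply_not g.1 hk
      rwa [← flipBool_not] at this
  have hn0 : (n : ZMod p) ≠ 0 := by
    intro hn0
    have := g.1.1.injective ((hform ⟨0, hr⟩ 0 false).trans
      (Eq.trans (by simp [hn0]) (hform ⟨0, hr⟩ 1 false).symm))
    exact zero_ne_one (blockPoint_inj.1 this).2.1
  have hπ : Function.Injective π := by
    intro i j hij
    obtain ⟨u, hu⟩ := exists_flipBool_eq (flipBool (t j) false) (flipBool (t i) false)
    -- If blocks `i` and `j` had the same image, this point of block `j`, found by solving the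
    -- affine equation, would collide with the base point of block `i`.
    have := g.1.1.injective (a₁ := blockPoint i 0 false)
      (a₂ := blockPoint j ((n : ZMod p)⁻¹ * (c i - c j)) (flipBool u false)) (by
        rw [hform, hform, hij, flipBool_comm, hu, mul_inv_cancel_left₀ hn0]
        congr 1
        ring)
    exact (blockPoint_inj.1 this).1
  exact ⟨Equiv.ofBijective π (Finite.injective_iff_bijective.1 hπ), n, c, t, hn0, hform⟩

theorem exists_perm_tauHom_conj (hr : 0 < r) (g : normR r p) :
    ∃ σ : Equiv.Perm (Fin r), ∀ t, g * tauHom r p t * g⁻¹ = tauHom r p (t ∘ σ) := by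
  obtain ⟨π, m, c, u, -, hg⟩ := normR_exists_coordinates hr g
  refine ⟨π.symm, fun t => ?_⟩
  rw [mul_inv_eq_iff_eq_mul]
  refine normR_ext fun j k b => ?_
  simp only [Subgroup.coe_mul, Equiv.Perm.mul_apply, hg, tauHom_blockPoint,
    Function.comp_apply, Equiv.symm_apply_apply]
  rw [flipBool_comm]

variable (r p) in
/-- The subgroup `⟨σ_1, …, σ_r⟩`, as the group of all shifts inside the blocks. -/
def shiftSubgroup : Subgroup (normR r p) where
  carrier := {g | ∃ a : Fin r → ZMod p, ∀ j k b,
    g.1.1 (blockPoint j k b) = blockPoint j (k + a j) b}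
  one_mem' := ⟨0, fun j k b => by simp⟩
  mul_mem' := by
    rintro g h ⟨a, ha⟩ ⟨a', ha'⟩
    refine ⟨a' + a, fun j k b => ?_⟩
    rw [Subgroup.coe_mul, Subgroup.coe_mul, Equiv.Perm.mul_apply, ha', ha, Pi.add_apply, add_assoc]
  inv_mem' := by
    rintro g ⟨a, ha⟩
    refine ⟨-a, fun j k b => ?_⟩
    rw [Subgroup.coe_inv, Subgroup.coe_inv, Equiv.Perm.inv_eq_iff_eq, ha, Pi.neg_apply,
      neg_add_cancel_right]

/-- Conjugating a translation by an affine map of slope `m` multiplies its length by `m`. -/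
theorem shiftSubgroup_normal (hr : 0 < r) : (shiftSubgroup r p).Normal where
  conj_mem := by
    rintro h ⟨a, ha⟩ g
    obtain ⟨π, m, c, t, -, hg⟩ := normR_exists_coordinates hr g
    refine ⟨fun i => m * a (π.symm i), fun j k b => ?_⟩
    obtain ⟨j', k', b', hy⟩ := exists_eq_blockPoint (r := r) (p := p)
      ((g.1.1)⁻¹ (blockPoint j k b))
    rw [Equiv.Perm.inv_eq_iff_eq, hg, blockPoint_inj] at hy
    obtain ⟨rfl, rfl, rfl⟩ := hy
    simp only [Subgroup.coe_mul, Equiv.Perm.mul_apply, Subgroup.coe_inv]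
    rw [← hg, Equiv.Perm.inv_def, Equiv.symm_apply_apply, ha, hg, Equiv.symm_apply_apply]
    congr 1
    ring

theorem pow_blockPoint {g : normR r p} {a : Fin r → ZMod p} {t : Fin r → ℤˣ}
    (hg : ∀ j k b, g.1.1 (blockPoint j k b) = blockPoint j (k + a j) (flipBool (t j) b)) (n : ℕ)
    (j : Fin r) (k : ZMod p) (b : Bool) : (g ^ n).1.1 (blockPoint j k b) =
      blockPoint j (k + (n : ZMod p) * a j) (flipBool ((t ^ n) j) b) := by
  induction n with
  | zero => simp [flipBool_one]
  | succ n ih =>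
    rw [pow_succ', Subgroup.coe_mul, Subgroup.coe_mul, Equiv.Perm.mul_apply, ih, hg, pow_succ',
      Pi.mul_apply, flipBool_mul]
    congr 1
    push_cast
    ring

theorem pow_prime_eq_tauHom {g : normR r p} {a : Fin r → ZMod p} {t : Fin r → ℤˣ}
    (hg : ∀ j k b, g.1.1 (blockPoint j k b) = blockPoint j (k + a j) (flipBool (t j) b)) :
    g ^ p = tauHom r p (t ^ p) :=
  normR_ext fun j k b => by
    rw [pow_blockPoint hg, tauHom_blockPoint, CharP.cast_eq_zero, zero_mul, add_zero]

theorem isPGroup_shiftSubgroup : IsPGroup p (shiftSubgroup r p) := by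
  rintro ⟨g, a, ha⟩
  refine ⟨1, Subtype.ext ?_⟩
  rw [pow_one]
  refine (pow_prime_eq_tauHom (a := a) (t := 1) fun j k b => ?_).trans (by simp)
  rw [ha, Pi.one_apply, flipBool_one]

/-- Commuting with σ_j forces `m = 1` if `π` fixes `j` and `m = 0` otherwise. Since `m ≠ 0`, every
block is fixed and the slope is 1. -/
theorem exists_coordinates_of_mem_centralizer (hr : 0 < r) {g : normR r p}
    (hg : g ∈ Subgroup.centralizer (shiftSubgroup r p : Set (normR r p))) :
    ∃ (a : Fin r → ZMod p) (t : Fin r → ℤˣ),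
      ∀ j k b, g.1.1 (blockPoint j k b) = blockPoint j (k + a j) (flipBool (t j) b) := by
  obtain ⟨π, m, c, t, hm, h⟩ := normR_exists_coordinates hr g
  have key : ∀ j, m = if π j = j then 1 else 0 := by
    intro j
    let s : normR r p := ⟨sigmaCycle r p j, mem_normR_of_commute
      (hyperoctahedral_ext fun i k b => by
        simp only [Subgroup.coe_mul, Equiv.Perm.mul_apply, sigmaProd_blockPoint,
          sigmaCycle_blockPoint]
        split_ifs <;> rfl)⟩
    have hs : s ∈ shiftSubgroup r p := ⟨fun i => if i = j then 1 else 0, fun i k b => by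
      refine (sigmaCycle_blockPoint j i k b).trans ?_
      split_ifs with hij <;> simp [hij]⟩
    have h1 := Subgroup.mem_centralizer_iff.1 hg s hs
    have h2 := DFunLike.congr_fun (congrArg (fun x => x.1.1) h1) (blockPoint j 0 false)
    simp only [Subgroup.coe_mul, Equiv.Perm.mul_apply] at h2
    simp only [s, sigmaCycle_blockPoint, h, blockPoint_inj, if_true] at h2
    have h3 := h2.2.1
    split_ifs at h3 ⊢ <;> simpa using h3.symm
  have hπ : ∀ j, π j = j := fun j => by
    by_contra hj
    exact hm ((key j).trans (if_neg hj))
  have hm1 : m = 1 := by rw [key ⟨0, hr⟩, if_pos (hπ _)]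
  refine ⟨c, t, fun j k b => ?_⟩
  rw [h, hπ, hm1, one_mul, add_comm]

theorem centralizer_shiftSubgroup_comm (hr : 0 < r) {g h : normR r p}
    (hg : g ∈ Subgroup.centralizer (shiftSubgroup r p : Set (normR r p)))
    (hh : h ∈ Subgroup.centralizer (shiftSubgroup r p : Set (normR r p))) : g * h = h * g := by
  obtain ⟨a, t, hg⟩ := exists_coordinates_of_mem_centralizer hr hg
  obtain ⟨a', t', hh⟩ := exists_coordinates_of_mem_centralizer hr hh
  refine normR_ext fun j k b => ?_
  simp only [Subgroup.coe_mul, Equiv.Perm.mul_apply, hg, hh]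
  rw [flipBool_comm, add_right_comm]

/-- Shifts never change bars. This yields the injectivity of `T` into `N/P`. -/
theorem eq_one_of_tauHom_mem_shiftSubgroup {t : Fin r → ℤˣ}
    (h : tauHom r p t ∈ shiftSubgroup r p) : t = 1 := by
  obtain ⟨a, ha⟩ := h
  ext1 j
  have h1 := ha j 0 false
  rw [tauHom_blockPoint, blockPoint_inj] at h1
  exact flipBool_left_injective false (h1.2.2.trans (flipBool_one false).symm)

theorem tauHom_injective : Function.Injective (tauHom r p) :=
  (injective_iff_map_eq_one _).2 fun _ h =>
    eq_one_of_tauHom_mem_shiftSubgroup (h ▸ (shiftSubgroup r p).one_mem)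

theorem exists_eq_mapDomain_tauHom {F : Type*} [Field F] [CharP F p] (hr : 0 < r)
    {f : MonoidAlgebra F (normR r p)} (hfc : f ∈ Set.center (MonoidAlgebra F (normR r p)))
    (hf : IsIdempotentElem f) :
    ∃ d, f = MonoidAlgebra.mapDomainRingHom F (tauHom r p) d := by
  have := shiftSubgroup_normal (p := p) hr
  refine MonoidAlgebra.exists_eq_mapDomain_of_mem_center (tauHom r p) isPGroup_shiftSubgroup
    (fun c hc c' hc' => centralizer_shiftSubgroup_comm hr hc hc') (fun c hc => ?_) ?_ hfc hf
  · obtain ⟨a, t, h⟩ := exists_coordinates_of_mem_centralizer hr hc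
    exact ⟨_, pow_prime_eq_tauHom h⟩
  · exact (injective_iff_map_eq_one _).2 fun t ht =>
      eq_one_of_tauHom_mem_shiftSubgroup ((QuotientGroup.eq_one_iff _).1 ht)

end Normaliser

/-! ### Modules in a block, and the bijection -/

/-- If the idempotent acts as 1, then `x` is the sum of its components under the `signIdem F S` with
|S| = v, and each component lies in V_S. Conversely the idempotent acts on each such V_S by the
scalar 1. -/
theorem asAlgebraHom_levelIdem_eq_one_iff {F V : Type*} [Field F] (h2 : (2 : F) ≠ 0) {r p : ℕ}
    [NeZero p] [AddCommGroup V] [Module F V] (ρ : Representation F (normR r p) V) (v : ℕ) :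
    ρ.asAlgebraHom (MonoidAlgebra.mapDomainRingHom F (tauHom r p) (levelIdem (Fin r) F v)) = 1 ↔
      BelongsTo ρ v := by
  constructor
  · intro h
    refine eq_top_iff.2 fun x _ => ?_
    rw [← Module.End.one_apply (R := F) x, ← h, levelIdem, map_sum, map_sum, LinearMap.sum_apply]
    refine Submodule.sum_mem _ fun S hS => ?_
    refine Submodule.mem_iSup_of_mem ⟨S, (Finset.mem_filter.1 hS).2⟩ fun j => ?_
    have hj : ρ (tau r p j) = ρ.asAlgebraHom (MonoidAlgebra.mapDomainRingHom F (tauHom r p)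
        (MonoidAlgebra.single (signGen j) 1)) := by
      rw [MonoidAlgebra.mapDomainRingHom_apply, MonoidAlgebra.mapDomain_single,
        Representation.asAlgebraHom_single_one]
      exact congrArg ρ (tauHom_signGen j).symm
    rw [hj, ← Module.End.mul_apply, ← map_mul, ← map_mul, mul_signIdem,
      MonoidAlgebra.lift_single, one_smul, signChar_gen]
    split_ifs with hjS
    · rw [one_smul]
    · rw [neg_one_smul, map_neg, map_neg, LinearMap.neg_apply]
  · intro h
    ext x
    have hx : x ∈ ⨆ S : {S : Finset (Fin r) // S.card = v}, weightSpace ρ S.1 := by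
      rw [show _ = _ from h]; trivial
    rw [Module.End.one_apply]
    induction hx using Submodule.iSup_induction' with
    | mem S x hx =>
      rw [asAlgebraHom_mapDomain_apply ρ (tauHom r p) (S := S.1)
        (fun j => by rw [tauHom_signGen]; exact hx j), signEval_levelIdem h2, if_pos S.2, one_smul]
    | zero => exact map_zero _
    | add x y _ _ hx hy => rw [map_add, hx, hy]

theorem proposition5p1 {F : Type u} [Field F] (p : ℕ) (hp : p.Prime) (hp2 : p ≠ 2) [CharP F p]
    (r : ℕ) (hr : 0 < r) :
    ∃ b : {x : ℕ × ℕ // x.1 + x.2 = r} ≃ Block F (normR r p),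
      ∀ (x : {x : ℕ × ℕ // x.1 + x.2 = r})
        (V : Type u) [AddCommGroup V] [Module F V] (ρ : Representation F (normR r p) V),
        LiesInBlock ρ (b x) ↔ BelongsTo ρ x.1.1 := by
  have : Fact p.Prime := ⟨hp⟩
  have h2 : (2 : F) ≠ 0 := Ring.two_ne_zero ((ringChar.eq F p).symm ▸ hp2)
  have hcard : Fintype.card (Fin r) = r := Fintype.card_fin r
  let e : {x : ℕ × ℕ // x.1 + x.2 = r} → Block F (normR r p) := fun x =>
    ⟨_, isBlockIdempotent_levelIdem (tauHom r p) tauHom_injective h2 (exists_perm_tauHom_conj hr)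
      exists_tauHom_conj_eq_comp (fun f hfc hf => exists_eq_mapDomain_tauHom hr hfc hf)
      (v := x.1.1) (by have := x.2; omega)⟩
  refine ⟨Equiv.ofBijective e ⟨?_, ?_⟩, fun x V _ _ ρ =>
    asAlgebraHom_levelIdem_eq_one_iff h2 ρ x.1.1⟩
  · rintro ⟨⟨v, w⟩, hx⟩ ⟨⟨v', w'⟩, hx'⟩ h
    have h1 : levelIdem (Fin r) F v = levelIdem (Fin r) F v' :=
      MonoidAlgebra.mapDomain_injective tauHom_injective (congrArg Subtype.val h)
    have hv : v = v' := by
      obtain ⟨S, -, hS⟩ := Finset.exists_subset_card_eq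
        (s := (Finset.univ : Finset (Fin r))) (n := v) (by simp at hx ⊢; omega)
      have h3 := signEval_levelIdem h2 v' S
      rw [← h1, signEval_levelIdem h2, if_pos hS] at h3
      by_contra hne
      rw [if_neg (hS ▸ hne)] at h3
      exact one_ne_zero h3
    simp only at hx hx'
    exact Subtype.ext (Prod.ext hv (by simp only; omega))
  · rintro ⟨B, hB⟩
    obtain ⟨v, hv, rfl⟩ := hB.exists_eq_levelIdem (tauHom r p) tauHom_injective h2
      (exists_perm_tauHom_conj hr) exists_tauHom_conj_eq_comp
      (fun f hfc hf => exists_eq_mapDomain_tauHom hr hfc hf)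
    exact ⟨⟨(v, r - v), by simp at hv ⊢; omega⟩, rfl⟩
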